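/- Theorem 3. Let $n$ be a natural number and let $[n]=\{1,\dots,n\}$ be a set of agents, each owning a dataset. An exchange is a matrix $x\in[0,1]^{n\times n}$, where $x_{ij}$ is the fraction of agent $i$'s dataset given to agent $j$; agent $i$ receives the bundle $x_i=(x_{1i},\dots,x_{ni})\in[0,1]^n$. Each agent $i$ has a utility function $u_i:[0,1]^n\to[0,1]$ that is continuous and non-decreasing in every coordinate. Let $\psi_{ij}:[0,1]^n\to[0,1]$ $(i,j\in[n])$ be continuous share functions; that is, for all $i,j\in[n]$ and all bundles $b\in[0,1]^n$: (i) (monotonicity) $\psi_{ij}(b)$ is non-decreasing in $b_i$ when the other coordinates of $b$ are fixed; (ii) (normalization) $\psi_{ij}(b)=0$ if $b_i=0$; (iii) (efficiency) $u_j(b)=\sum_{k\in[n]}\psi_{kj}(b)$. Then for every $\varepsilon\in(0,1)$ there is an exchange $x$ that is both - reciprocal: $\sum_{j\in[n]}\psi_{ij}(x_j)=u_i(x_i)$ for every agent $i$; and - $\varepsilon$-core-stable: for no nonempty set $S\subseteq[n]$ is there an exchange $y$ among the agents of $S$ (that is, $y\in[0,1]^{n\times n}$ with $y_{ij}=0$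 unless $i,j\in S$) such that $u_i(y_i)>u_i(x_i)+\varepsilon$ for all $i\in S$. -/

import Mathlib

namespace DataExchange

/-- A bundle of (fractional) datasets: the `k`-th entry is the fraction of the dataset of agent `k`
contained in the bundle. -/
abbrev Bundle (n : ℕ) : Type := Fin n → unitInterval

/-- An exchange `x ∈ [0,1]^{n × n}`: the entry `x i j` is the fraction of the dataset of agent `i`
that agent `i` gives to agent `j`. -/
abbrev Exchange (n : ℕ) : Type := Fin n → Fin n → unitInterval

/-- The bundle `(x_{1i}, …, x_{ni})` that agent `i` receives in the exchange `x`. -/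
def Exchange.bundle {n : ℕ} (x : Exchange n) (i : Fin n) : Bundle n := fun k => x k i

/-- A data exchange instance on the agents `Fin n`: each agent has a utility function
`[0,1]^n → [0,1]` on bundles, non-decreasing in every coordinate (`Bundle n` is ordered
coordinatewise). The datasets enter only through the fractions exchanged. -/
structure Instance (n : ℕ) where
  /-- `u i b` is the utility of agent `i` for the bundle `b`. -/
  u : Fin n → Bundle n → unitInterval
  monotone_u : ∀ i, Monotone (u i)

/-- Share functions for an instance: `ψ i j b` is the contribution of agent `i` to the utility of
agent `j` when `j` receives the bundle `b`. (Normalization and efficiency force `u j 0 = 0`.) -/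
structure IsShare {n : ℕ} (I : Instance n) (ψ : Fin n → Fin n → Bundle n → unitInterval) :
    Prop where
  /-- `ψ i j` is non-decreasing in the coordinate of agent `i`, the others being fixed. -/
  monotone : ∀ i j (b : Bundle n), Monotone fun t : unitInterval => ψ i j (Function.update b i t)
  normalized : ∀ i j (b : Bundle n), b i = 0 → ψ i j b = 0
  efficient : ∀ j (b : Bundle n), (I.u j b : ℝ) = ∑ i, (ψ i j b : ℝ)

/-- The surplus `Δ_i(x)`: the total contribution of agent `i` minus the utility of agent `i`. -/
def surplus {n : ℕ} (I : Instance n) (ψ : Fin n → Fin n → Bundle n → unitInterval)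
    (x : Exchange n) (i : Fin n) : ℝ :=
  ∑ j, (ψ i j (x.bundle j) : ℝ) - (I.u i (x.bundle i) : ℝ)

/-- `x` is `δ`-reciprocal if every surplus is at most `δ` in absolute value. -/
def IsApproxReciprocal {n : ℕ} (I : Instance n) (ψ : Fin n → Fin n → Bundle n → unitInterval)
    (δ : ℝ) (x : Exchange n) : Prop :=
  ∀ i, |surplus I ψ x i| ≤ δ

/-- A reciprocal exchange is a `0`-reciprocal one. -/
def IsReciprocal {n : ℕ} (I : Instance n) (ψ : Fin n → Fin n → Bundle n → unitInterval)
    (x : Exchange n) : Prop :=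
  IsApproxReciprocal I ψ 0 x

/-- `y` is an exchange among the agents of `S` only: nothing is given by or to other agents. -/
def Exchange.IsAmong {n : ℕ} (y : Exchange n) (S : Finset (Fin n)) : Prop :=
  ∀ i j, i ∉ S ∨ j ∉ S → y i j = 0

/-- `x` is `ε`-core-stable if no (nonempty) coalition `S` has an exchange among its own agents that
gives each of them more than `ε` above the utility in `x`. -/
def IsCoreStable {n : ℕ} (I : Instance n) (ε : ℝ) (x : Exchange n) : Prop :=
  ∀ S : Finset (Fin n), S.Nonempty →
    ¬ ∃ y : Exchange n, y.IsAmong S ∧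
      ∀ i ∈ S, (I.u i (y.bundle i) : ℝ) > (I.u i (x.bundle i) : ℝ) + ε

end DataExchange

/-! Rank the agents by priorities `q` and let each give everything to those of at least its own
priority, with a linear cutoff of width `δ` below. The member of highest priority in a coalition
already receives all its partners' data, so by monotonicity it cannot gain
(`exists_utility_le_priorityExchange`). It remains to choose `q` so that the surpluses vanish in the
limit. A Walras-type identity gives `∑ q i * Δ i = ∑ (q i - q j) * ψ i j`, which is at most `n² δ`,
because `ψ i j = 0` once `q i ≥ q j + δ`. If `q` lies in the simplex and charges only maximal
surpluses (`stdSimplex.exists_complementary`), this weighted sum is the largest surplus. As `δ → 0`,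
compactness gives an exchange with all surpluses nonpositive; they sum to zero, so they vanish.
Blocking by strict gains is an open condition, so stability survives the limit, even without `ε`.

Complementarity follows from Scarf's lemma (`Scarf.exists_dominant_colorful`): grid points are
coloured by a maximal coordinate of `F`, a dominant set carrying all colours has its grid points
close together, and the mesh tends to zero. -/

/-- A map whose image has exactly one element less than its domain identifies exactly one pair of
points, and these are the points that can be removed without changing the image. -/
theorem Finset.exists_pair_of_card_image_succ {α β : Type*} [DecidableEq α] [DecidableEq β]
    (s : Finset α) (f : α → β) (h : (s.image f).card + 1 = s.card) :
    ∃ x ∈ s, ∃ y ∈ s, x ≠ y ∧ f x = f y ∧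
      ∀ z ∈ s, ((s.erase z).image f = s.image f ↔ z = x ∨ z = y) := by
  obtain ⟨x, hx, y, hy, hxy, hf⟩ := Finset.exists_ne_map_eq_of_card_lt_of_maps_to
    (s := s) (t := s.image f) (by omega) (f := f) (fun a ha => Finset.mem_image_of_mem f ha)
  have key : ∀ a ∈ s, ∀ b ∈ s, a ≠ b → f a = f b → (s.erase a).image f = s.image f := by
    intro a ha b hb hab hfab
    apply Finset.Subset.antisymm (Finset.image_subset_image (Finset.erase_subset _ _))
    intro w hw
    obtain ⟨v, hv, rfl⟩ := Finset.mem_image.1 hw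
    by_cases hva : v = a
    · subst hva
      exact Finset.mem_image.2 ⟨b, Finset.mem_erase.2 ⟨hab.symm, hb⟩, hfab.symm⟩
    · exact Finset.mem_image_of_mem f (Finset.mem_erase.2 ⟨hva, hv⟩)
  have inj : ∀ a ∈ s, (s.erase a).image f = s.image f → Set.InjOn f (s.erase a) := by
    intro a ha he
    apply Finset.card_image_iff.1
    rw [he, Finset.card_erase_of_mem ha]
    omega
  refine ⟨x, hx, y, hy, hxy, hf, fun z hz => ⟨fun he => ?_, ?_⟩⟩
  · by_contra! hne
    exact hxy (inj z hz he (by simp [hx, hne.1.symm]) (by simp [hy, hne.2.symm]) hf)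
  · rintro (rfl | rfl)
    · exact key _ hx _ hy hxy hf
    · exact key _ hy _ hx hxy.symm hf.symm

/-! ### Scarf's lemma by parity. -/

namespace Scarf

variable {V I : Type*}

/-- A set `P` is dominant for the rankings `R i` if every point is ranked at most as high as all of
`P` by some `R i`. -/
def Dominant (R : I → V → ℕ) (P : Finset V) : Prop :=
  ∀ y, ∃ i, ∀ p ∈ P, R i y ≤ R i p

theorem Dominant.mono {R : I → V → ℕ} {P Q : Finset V} (h : Dominant R Q) (hPQ : P ⊆ Q) :
    Dominant R P := fun y =>
  let ⟨i, hi⟩ := h y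
  ⟨i, fun p hp => hi p (hPQ hp)⟩

/-- Adding a point that replaces the minimum of `R k` and is maximal with this property preserves
dominance. -/
theorem Dominant.insert_of_isMax [DecidableEq V] {R : I → V → ℕ} {τ : Finset V}
    (hτ : Dominant R τ) {m : I → V} (hmem : ∀ i, m i ∈ τ)
    (hmin : ∀ i, ∀ p ∈ τ, R i (m i) ≤ R i p) {k : I}
    {z : V} (hz : ∀ l, l ≠ k → R l (m l) < R l z)
    (hmax : ∀ v, (∀ l, l ≠ k → R l (m l) < R l v) → R k v ≤ R k z) :
    Dominant R (insert z τ) := by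
  intro y
  by_cases hy : ∀ l, l ≠ k → R l (m l) < R l y
  · obtain ⟨l, hl⟩ := hτ y
    have hlk : l = k := by
      by_contra hlk
      exact absurd (hl _ (hmem l)) (not_le.2 (hy l hlk))
    subst hlk
    refine ⟨l, fun p hp => ?_⟩
    rcases Finset.mem_insert.1 hp with rfl | hp
    · exact hmax y hy
    · exact hl p hp
  · push Not at hy
    obtain ⟨l, hlk, hl⟩ := hy
    refine ⟨l, fun p hp => ?_⟩
    rcases Finset.mem_insert.1 hp with rfl | hp
    · exact hl.trans (hz l hlk).le
    · exact hl.trans (hmin l p hp)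

/-- If adding `z` to `τ` preserves dominance, then `z` replaces the minimum of `R k` for one of the
two indices `k` that share their minimum on `τ`. -/
theorem Dominant.isMax_of_insert [DecidableEq V] {R : I → V → ℕ}
    (hR : ∀ i, Function.Injective (R i)) {τ : Finset V} {m : I → V} (hmem : ∀ i, m i ∈ τ)
    (hmin : ∀ i, ∀ p ∈ τ, R i (m i) ≤ R i p) {i j : I}
    (hi : Set.InjOn m {l | l ≠ i}) (hj : Set.InjOn m {l | l ≠ j}) (hij : i ≠ j)
    {z : V} (hz : z ∉ τ) (hP : Dominant R (insert z τ)) :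
    ∃ k, (k = i ∨ k = j) ∧ (∀ l, l ≠ k → R l (m l) < R l z) ∧
      ∀ v, (∀ l, l ≠ k → R l (m l) < R l v) → R k v ≤ R k z := by
  obtain ⟨k, hk⟩ := hP z
  -- Dominance tested at `p` yields a ranking whose minimum is `p` and which places `z` higher; it
  -- is not `k`, where `z` is lowest.
  have hrep : ∀ p ∈ τ, ∃ l, l ≠ k ∧ m l = p ∧ R l (m l) < R l z := by
    intro p hp
    obtain ⟨l, hl⟩ := hP p
    have hml : m l = p :=
      hR l (le_antisymm (hmin l p hp) (hl _ (Finset.mem_insert_of_mem (hmem l))))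
    have hpz : R l p < R l z := by
      refine lt_of_le_of_ne (hl z (Finset.mem_insert_self _ _)) fun h => hz ?_
      rw [← hR l h]; exact hp
    refine ⟨l, ?_, hml, hml ▸ hpz⟩
    rintro rfl
    exact absurd (hk p (Finset.mem_insert_of_mem hp)) (not_le.2 hpz)
  have hkij : k = i ∨ k = j := by
    by_contra! hne
    obtain ⟨l, hlk, hml, -⟩ := hrep _ (hmem k)
    by_cases hli : l = i
    · exact hlk (hj (by simpa [hli] using hij) hne.2 hml)
    · exact hlk (hi hli hne.1 hml)
  have hinj : Set.InjOn m {l | l ≠ k} := by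
    rcases hkij with rfl | rfl <;> assumption
  refine ⟨k, hkij, fun l hl => ?_, fun v hv => ?_⟩
  · obtain ⟨l', hl', hml, hlt⟩ := hrep _ (hmem l)
    rwa [hinj hl' hl hml] at hlt
  · obtain ⟨l, hl⟩ := hP v
    by_cases hlk : l = k
    · subst hlk
      exact hl z (Finset.mem_insert_self _ _)
    · exact absurd (hl _ (Finset.mem_insert_of_mem (hmem l))) (not_le.2 (hv l hlk))

open Classical in
/-- The candidates for replacing the minimum of `R k`. -/
noncomputable def above [Fintype V] (R : I → V → ℕ) (m : I → V) (k : I) : Finset V :=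
  Finset.univ.filter fun v => ∀ l, l ≠ k → R l (m l) < R l v

open Classical in
/-- The points that can be added to `τ` preserving dominance. -/
noncomputable def completions [Fintype V] (R : I → V → ℕ) (τ : Finset V) : Finset V :=
  Finset.univ.filter fun z => z ∉ τ ∧ Dominant R (insert z τ)

-- Dominance tested at points of `τ` makes each of them the minimum of some ranking, so exactly two
-- of the indices share a minimum. A completion takes over one of these two, as the highest
-- candidate there.
open Classical in
theorem card_completions [Fintype V] [Fintype I] [Nontrivial I] {R : I → V → ℕ}
    (hR : ∀ i, Function.Injective (R i)) {τ : Finset V} (hτ : Dominant R τ)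
    (hcard : τ.card + 1 = Fintype.card I) :
    ∃ (m : I → V) (i j : I), i ≠ j ∧ m i = m j ∧ (∀ l, m l ∈ τ) ∧
      (∀ l, ∀ p ∈ τ, R l (m l) ≤ R l p) ∧
      (completions R τ).card =
        (if (above R m i).Nonempty then 1 else 0) + (if (above R m j).Nonempty then 1 else 0) := by
  have hne : τ.Nonempty := by
    have := Fintype.one_lt_card (α := I)
    exact Finset.card_pos.1 (by omega)
  choose m hmem hmin using fun l => τ.exists_min_image (R l) hne
  have himg : Finset.univ.image m = τ := by
    apply Finset.Subset.antisymm
    · intro w hw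
      obtain ⟨l, -, rfl⟩ := Finset.mem_image.1 hw
      exact hmem l
    · intro p hp
      obtain ⟨l, hl⟩ := hτ p
      exact Finset.mem_image.2
        ⟨l, Finset.mem_univ _, hR l (le_antisymm (hmin l p hp) (hl _ (hmem l)))⟩
  obtain ⟨i, -, j, -, hij, hm, hiff⟩ := Finset.exists_pair_of_card_image_succ
    (Finset.univ : Finset I) m (by rw [himg, hcard, Finset.card_univ])
  have hinj : ∀ k, k = i ∨ k = j → Set.InjOn m {l | l ≠ k} := by
    intro k hk
    have h1 := (hiff k (Finset.mem_univ _)).2 hk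
    have h2 : Set.InjOn m (Finset.univ.erase k : Finset I) := by
      apply Finset.card_image_iff.1
      rw [h1, himg, Finset.card_erase_of_mem (Finset.mem_univ _), Finset.card_univ]
      omega
    intro a ha b hb hab
    exact h2 (by simpa using ha) (by simpa using hb) hab
  refine ⟨m, i, j, hij, hm, hmem, hmin, ?_⟩
  let W : I → Finset V := fun k =>
    (above R m k).filter fun z => ∀ v ∈ above R m k, R k v ≤ R k z
  have hWcard : ∀ k, (W k).card = if (above R m k).Nonempty then 1 else 0 := by
    intro k
    split_ifs with h
    · obtain ⟨z, hz, hzmax⟩ := (above R m k).exists_max_image (R k) h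
      rw [Finset.card_eq_one]
      refine ⟨z, ?_⟩
      ext w
      simp only [W, Finset.mem_filter, Finset.mem_singleton]
      constructor
      · rintro ⟨hw, hwmax⟩
        exact hR k (le_antisymm (hzmax w hw) (hwmax z hz))
      · rintro rfl
        exact ⟨hz, hzmax⟩
    · rw [Finset.not_nonempty_iff_eq_empty] at h
      simp [W, h]
  -- A common point would exceed the minimum of every ranking, against dominance of `τ`.
  have hdisj : Disjoint (W i) (W j) := by
    rw [Finset.disjoint_left]
    intro z hzi hzj
    simp only [W, above, Finset.mem_filter, Finset.mem_univ, true_and] at hzi hzj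
    obtain ⟨l, hl⟩ := hτ z
    have hl := hl _ (hmem l)
    by_cases hli : l = i
    · exact absurd hl (not_le.2 (hzj.1 l (hli ▸ hij)))
    · exact absurd hl (not_le.2 (hzi.1 l hli))
  have hnot : ∀ k, k = i ∨ k = j → ∀ z ∈ above R m k, z ∉ τ := by
    intro k hk z hz hzτ
    simp only [above, Finset.mem_filter, Finset.mem_univ, true_and] at hz
    have h1 : z ∈ (Finset.univ.erase k).image m := by
      rw [(hiff k (Finset.mem_univ _)).2 hk, himg]
      exact hzτ
    obtain ⟨l, hl, rfl⟩ := Finset.mem_image.1 h1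
    exact lt_irrefl _ (hz l (Finset.ne_of_mem_erase hl))
  have hunion : completions R τ = W i ∪ W j := by
    ext z
    simp only [completions, Finset.mem_filter, Finset.mem_univ, true_and, Finset.mem_union]
    constructor
    · rintro ⟨hz, hP⟩
      obtain ⟨k, hk, h1, h2⟩ := Dominant.isMax_of_insert hR hmem hmin
        (hinj i (Or.inl rfl)) (hinj j (Or.inr rfl)) hij hz hP
      have : z ∈ W k := by
        simp only [W, above, Finset.mem_filter, Finset.mem_univ, true_and]
        exact ⟨h1, h2⟩
      rcases hk with rfl | rfl
      · exact Or.inl this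
      · exact Or.inr this
    · have aux : ∀ k, k = i ∨ k = j → z ∈ W k → z ∉ τ ∧ Dominant R (insert z τ) := by
        intro k hk hz
        refine ⟨hnot k hk z (Finset.mem_filter.1 hz).1, ?_⟩
        simp only [W, above, Finset.mem_filter, Finset.mem_univ, true_and] at hz
        exact hτ.insert_of_isMax hmem hmin hz.1 hz.2
      rintro (hz | hz)
      · exact aux i (Or.inl rfl) hz
      · exact aux j (Or.inr rfl) hz
  rw [hunion, Finset.card_union_of_disjoint hdisj, hWcard, hWcard]

/-- Slack points for the rankings `R i`: `slack i` is the lowest point of `R i`, and it is above all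
points that are not slack in the other rankings. -/
structure IsSlack (R : I → V → ℕ) (slack : I → V) : Prop where
  injective : Function.Injective slack
  min : ∀ i v, R i (slack i) ≤ R i v
  lt : ∀ i j v, j ≠ i → v ∉ Set.range slack → R i v < R i (slack j)

theorem dominant_image_slack [Fintype I] [DecidableEq V] [DecidableEq I]
    {R : I → V → ℕ} {slack : I → V} (hs : IsSlack R slack) (i : I) :
    Dominant R ((Finset.univ.erase i).image slack) := by
  intro y
  by_cases hy : y ∈ Set.range slack
  · obtain ⟨l, rfl⟩ := hy
    exact ⟨l, fun p _ => hs.min l p⟩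
  · refine ⟨i, fun p hp => ?_⟩
    obtain ⟨l, hl, rfl⟩ := Finset.mem_image.1 hp
    exact (hs.lt i l y (Finset.ne_of_mem_erase hl) hy).le

section Slack

variable [Fintype V] [Fintype I] [Nontrivial I] {R : I → V → ℕ} {slack : I → V}

/-- A point of `τ` that is not slack keeps every minimum below the foreign slack points, so `slack
k` is a candidate for each `k`. -/
theorem card_completions_of_exists (hR : ∀ i, Function.Injective (R i)) (hs : IsSlack R slack)
    {τ : Finset V} (hτ : Dominant R τ) (hcard : τ.card + 1 = Fintype.card I)
    (hreal : ∃ t ∈ τ, t ∉ Set.range slack) : (completions R τ).card = 2 := by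
  obtain ⟨m, i, j, -, -, -, hmin, hc⟩ := card_completions hR hτ hcard
  obtain ⟨t, ht, htr⟩ := hreal
  have hne : ∀ k, (above R m k).Nonempty := by
    intro k
    refine ⟨slack k, ?_⟩
    simp only [above, Finset.mem_filter, Finset.mem_univ, true_and]
    exact fun l hl => (hmin l t ht).trans_lt (hs.lt l k t hl.symm htr)
  rw [hc, if_pos (hne i), if_pos (hne j)]

/-- This is the boundary face. Index `i` shares its minimum `slack k` with some `k`; replacing at
`k` would need a point above `slack k` in `R i`, which only other slack points can be, and these
fail in their own rankings. -/
theorem card_completions_image_slack [DecidableEq V] [DecidableEq I]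
    (hR : ∀ i, Function.Injective (R i)) (hs : IsSlack R slack) (i : I) :
    (completions R ((Finset.univ.erase i).image slack)).card = 1 := by
  have hcard : ((Finset.univ.erase i).image slack).card + 1 = Fintype.card I := by
    rw [Finset.card_image_of_injective _ hs.injective,
      Finset.card_erase_of_mem (Finset.mem_univ _), Finset.card_univ]
    have := Fintype.one_lt_card (α := I)
    omega
  obtain ⟨m, a, b, hab, hmab, hmem, hmin, hc⟩ :=
    card_completions hR (dominant_image_slack hs i) hcard
  have hm : ∀ l, l ≠ i → m l = slack l := fun l hl =>
    hR l (le_antisymm (hmin l _ (Finset.mem_image.2 ⟨l, by simp [hl], rfl⟩)) (hs.min l _))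
  have hi : (above R m i).Nonempty := by
    refine ⟨slack i, ?_⟩
    simp only [above, Finset.mem_filter, Finset.mem_univ, true_and]
    intro l hl
    rw [hm l hl]
    exact lt_of_le_of_ne (hs.min l _) fun h => hl (hs.injective (hR l h))
  have hother : ∀ k, k ≠ i → m i = m k → ¬ (above R m k).Nonempty := by
    rintro k hk hmk ⟨v, hv⟩
    simp only [above, Finset.mem_filter, Finset.mem_univ, true_and] at hv
    have h1 := hv i hk.symm
    rw [hmk, hm k hk] at h1
    by_cases hvr : v ∈ Set.range slack
    · obtain ⟨l, rfl⟩ := hvr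
      by_cases hli : l = i
      · subst hli
        exact absurd (hs.min l (slack k)) (not_le.2 h1)
      · by_cases hlk : l = k
        · subst hlk; exact lt_irrefl _ h1
        · have := hv l hlk
          rw [hm l hli] at this
          exact lt_irrefl _ this
    · exact absurd (hs.lt i k v hk hvr) (not_lt.2 h1.le)
  have hai : a = i ∨ b = i := by
    by_contra! h
    rw [hm a h.1, hm b h.2] at hmab
    exact hab (hs.injective hmab)
  rcases hai with rfl | rfl
  · rw [hc, if_pos hi, if_neg (hother b hab.symm hmab)]
  · rw [hc, if_pos hi, if_neg (hother a hab hmab.symm)]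

/-- Scarf's lemma: some dominant set carries all the colours. -/
theorem exists_dominant_colorful [DecidableEq I] (hR : ∀ i, Function.Injective (R i))
    (hs : IsSlack R slack) (c : V → I) (hc : ∀ i, c (slack i) = i) :
    ∃ P : Finset V, Dominant R P ∧ P.card = Fintype.card I ∧ P.image c = Finset.univ := by
  classical
  by_contra! hno
  have hI := Fintype.one_lt_card (α := I)
  obtain ⟨i₀⟩ : Nonempty I := inferInstance
  -- Incidences `τ ⊆ P` between `D` and `Q` are counted twice: each `P` has two faces in `D`, each
  -- `τ` two completions, except a single face with one. The total would be both even and odd.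
  let D : Finset (Finset V) := Finset.univ.filter fun τ =>
    Dominant R τ ∧ τ.card + 1 = Fintype.card I ∧ τ.image c = Finset.univ.erase i₀
  let Q : Finset (Finset V) := Finset.univ.filter fun P =>
    Dominant R P ∧ P.card = Fintype.card I ∧ P.image c = Finset.univ.erase i₀
  have hdc := Finset.sum_card_bipartiteAbove_eq_sum_card_bipartiteBelow
    (s := D) (t := Q) (fun τ P => τ ⊆ P)
  have hQ : ∀ P ∈ Q, (D.bipartiteBelow (fun τ P => τ ⊆ P) P).card = 2 := by
    intro P hP
    simp only [Q, Finset.mem_filter, Finset.mem_univ, true_and] at hP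
    obtain ⟨hdom, hcard, himg⟩ := hP
    obtain ⟨x, hx, y, hy, hxy, -, hiff⟩ := Finset.exists_pair_of_card_image_succ P c (by
      rw [himg, Finset.card_erase_of_mem (Finset.mem_univ _), Finset.card_univ, hcard]; omega)
    have heq : D.bipartiteBelow (fun τ P => τ ⊆ P) P = {P.erase x, P.erase y} := by
      ext τ
      simp only [D, Finset.bipartiteBelow, Finset.mem_filter, Finset.mem_univ, true_and,
        Finset.mem_insert, Finset.mem_singleton]
      constructor
      · rintro ⟨⟨-, hτc, hτi⟩, hsub⟩
        obtain ⟨z, hz, rfl⟩ : ∃ z ∈ P, P.erase z = τ := by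
          have h1 : (P \ τ).card = 1 := by
            rw [Finset.card_sdiff_of_subset hsub]; omega
          obtain ⟨z, hz⟩ := Finset.card_eq_one.1 h1
          refine ⟨z, (Finset.mem_sdiff.1 (hz ▸ Finset.mem_singleton_self z)).1, ?_⟩
          rw [Finset.erase_eq, ← hz, Finset.sdiff_sdiff_eq_self hsub]
        rcases (hiff z hz).1 (hτi.trans himg.symm) with rfl | rfl
        · exact Or.inl rfl
        · exact Or.inr rfl
      · have aux : ∀ z ∈ P, z = x ∨ z = y → τ = P.erase z → (Dominant R τ ∧
            τ.card + 1 = Fintype.card I ∧ τ.image c = Finset.univ.erase i₀) ∧ τ ⊆ P := by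
          rintro z hz hzxy rfl
          refine ⟨⟨hdom.mono (Finset.erase_subset _ _), ?_, ?_⟩, Finset.erase_subset _ _⟩
          · rw [Finset.card_erase_of_mem hz]; omega
          · rw [(hiff z hz).2 hzxy, himg]
        rintro (h | h)
        · exact aux x hx (Or.inl rfl) h
        · exact aux y hy (Or.inr rfl) h
    rw [heq, Finset.card_pair]
    intro h
    have : x ∈ P.erase y := Finset.mem_erase.2 ⟨hxy, hx⟩
    rw [← h] at this
    exact Finset.notMem_erase x P this
  have hD : ∀ τ ∈ D, (Q.bipartiteAbove (fun τ P => τ ⊆ P) τ).card = (completions R τ).card := by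
    intro τ hτ
    simp only [D, Finset.mem_filter, Finset.mem_univ, true_and] at hτ
    obtain ⟨hdom, hcard, himg⟩ := hτ
    symm
    apply Finset.card_bij (fun z _ => insert z τ)
    · intro z hz
      simp only [completions, Finset.mem_filter, Finset.mem_univ, true_and] at hz
      simp only [Q, Finset.bipartiteAbove, Finset.mem_filter, Finset.mem_univ, true_and]
      have hcd : (insert z τ).card = Fintype.card I := by
        rw [Finset.card_insert_of_notMem hz.1, hcard]
      refine ⟨⟨hz.2, hcd, ?_⟩, Finset.subset_insert _ _⟩
      -- A completion of colour `i₀` would carry all colours.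
      have hne := hno _ hz.2 hcd
      rw [Finset.image_insert, himg] at hne ⊢
      by_cases hcz : c z = i₀
      · exact absurd (by rw [hcz, Finset.insert_erase (Finset.mem_univ _)]) hne
      · exact Finset.insert_eq_of_mem (by simp [hcz])
    · intro z hz w hw h
      simp only [completions, Finset.mem_filter, Finset.mem_univ, true_and] at hz hw
      have : z ∈ insert w τ := h ▸ Finset.mem_insert_self z τ
      exact (Finset.mem_insert.1 this).resolve_right hz.1
    · intro P hP
      simp only [Q, Finset.bipartiteAbove, Finset.mem_filter, Finset.mem_univ, true_and] at hP
      obtain ⟨⟨hPd, hPc, -⟩, hsub⟩ := hP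
      have h1 : (P \ τ).card = 1 := by
        rw [Finset.card_sdiff_of_subset hsub]; omega
      obtain ⟨z, hz⟩ := Finset.card_eq_one.1 h1
      have hins : insert z τ = P := by
        rw [Finset.insert_eq, ← hz, Finset.sdiff_union_of_subset hsub]
      refine ⟨z, ?_, hins⟩
      simp only [completions, Finset.mem_filter, Finset.mem_univ, true_and, hins]
      exact ⟨(Finset.mem_sdiff.1 (hz ▸ Finset.mem_singleton_self z)).2, hPd⟩
  set τ₀ := (Finset.univ.erase i₀).image slack with hτ₀
  have hτ₀D : τ₀ ∈ D := by
    simp only [D, Finset.mem_filter, Finset.mem_univ, true_and]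
    refine ⟨dominant_image_slack hs i₀, ?_, ?_⟩
    · rw [hτ₀, Finset.card_image_of_injective _ hs.injective,
        Finset.card_erase_of_mem (Finset.mem_univ _), Finset.card_univ]
      omega
    · rw [hτ₀, Finset.image_image]
      simp [Function.comp_def, hc]
  have hrest : ∀ τ ∈ D.erase τ₀, (completions R τ).card = 2 := by
    intro τ hτ
    obtain ⟨hne, hτ⟩ := Finset.mem_erase.1 hτ
    simp only [D, Finset.mem_filter, Finset.mem_univ, true_and] at hτ
    refine card_completions_of_exists hR hs hτ.1 hτ.2.1 ?_
    by_contra! hall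
    apply hne
    apply Finset.eq_of_subset_of_card_le
    · intro t ht
      obtain ⟨l, rfl⟩ := hall t ht
      have : c (slack l) ∈ τ.image c := Finset.mem_image_of_mem c ht
      rw [hτ.2.2, hc] at this
      exact Finset.mem_image_of_mem _ this
    · rw [hτ₀, Finset.card_image_of_injective _ hs.injective,
        Finset.card_erase_of_mem (Finset.mem_univ _), Finset.card_univ]
      omega
  rw [Finset.sum_congr rfl hD, Finset.sum_congr rfl hQ, ← Finset.add_sum_erase _ _ hτ₀D,
    Finset.sum_congr rfl hrest, card_completions_image_slack hR hs i₀] at hdc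
  simp only [Finset.sum_const, smul_eq_mul] at hdc
  omega

end Slack

end Scarf

/-! ### Complementarity on the simplex. -/

/-- Any function to `ℕ` on a finite type is refined by an injective one. -/
theorem exists_injective_refinement {V : Type*} [Fintype V] (f : V → ℕ) :
    ∃ g : V → ℕ, Function.Injective g ∧ ∀ v w, f v < f w → g v < g w := by
  let e := Fintype.equivFin V
  have hlt : ∀ v w, f v < f w →
      f v * Fintype.card V + (e v : ℕ) < f w * Fintype.card V + (e w : ℕ) := by
    intro v w h
    have h1 : (f v + 1) * Fintype.card V ≤ f w * Fintype.card V := Nat.mul_le_mul_right _ h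
    have h2 := (e v).isLt
    rw [add_mul, one_mul] at h1
    omega
  refine ⟨fun v => f v * Fintype.card V + (e v : ℕ), fun v w h => ?_, hlt⟩
  rcases lt_trichotomy (f v) (f w) with h1 | h1 | h1
  · exact absurd h (hlt _ _ h1).ne
  · apply e.injective
    apply Fin.ext
    simp only [h1] at h
    omega
  · exact absurd h (hlt _ _ h1).ne'

/-- The points of `ℕ^I` with coordinate sum `N`. -/
abbrev GridPoint (I : Type*) [Fintype I] (N : ℕ) : Type _ :=
  {t : I → Fin (N + 1) // ∑ i, (t i : ℕ) = N}

theorem GridPoint.exists_ge {I : Type*} [Fintype I] [Nonempty I] {N : ℕ} (a : I → ℕ)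
    (ha : ∑ i, a i ≤ N) : ∃ t : GridPoint I N, ∀ i, a i ≤ t.1 i := by
  classical
  obtain ⟨i₀⟩ := ‹Nonempty I›
  let b : I → ℕ := fun i => a i + if i = i₀ then N - ∑ i, a i else 0
  have hb : ∑ i, b i = N := by
    simp only [b, Finset.sum_add_distrib, Finset.sum_ite_eq', Finset.mem_univ, if_true]
    omega
  have hbN : ∀ i, b i ≤ N := fun i =>
    (Finset.single_le_sum (fun _ _ => Nat.zero_le _) (Finset.mem_univ i)).trans hb.le
  exact ⟨⟨fun i => ⟨b i, Nat.lt_succ_of_le (hbN i)⟩, hb⟩, fun i => Nat.le_add_right _ _⟩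

/-- For every colouring of the grid points of a simplex there is a point `t` such that every
coordinate of `t` is small or a point of this colour is near `t`. -/
theorem GridPoint.exists_near_colors {I : Type*} [Fintype I] [Nontrivial I] (N : ℕ)
    (c : GridPoint I N → I) :
    ∃ t : GridPoint I N, ∀ i, (t.1 i : ℕ) ≤ Fintype.card I ∨
      ∃ s : GridPoint I N, c s = i ∧ ∀ j, (s.1 j : ℕ) ≤ t.1 j + Fintype.card I ∧
        (t.1 j : ℕ) ≤ s.1 j + Fintype.card I := by
  classical
  -- The shift by one puts slack `i` strictly below the grid points in ranking `i`; `N + 2` puts the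
  -- other slacks above them.
  let f : I → GridPoint I N ⊕ I → ℕ := fun i v =>
    Sum.elim (fun t => (t.1 i : ℕ) + 1) (fun j => if j = i then 0 else N + 2) v
  choose R hR hfR using fun i => exists_injective_refinement (f i)
  have hs : Scarf.IsSlack R Sum.inr := by
    refine ⟨Sum.inr_injective, fun i v => ?_, fun i j v hji hv => ?_⟩
    · by_cases hv : v = Sum.inr i
      · rw [hv]
      · refine (hfR i _ _ ?_).le
        rcases v with t | j
        · simp [f]
        · have : j ≠ i := fun h => hv (h ▸ rfl)
          simp [f, this]
    · rcases v with t | l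
      · apply hfR
        have := (t.1 i).isLt
        simp only [f, Sum.elim_inl, Sum.elim_inr, if_neg hji]
        omega
      · exact absurd ⟨l, rfl⟩ hv
  obtain ⟨P, hdom, -, himg⟩ := Scarf.exists_dominant_colorful hR hs (Sum.elim c id) (by simp)
  have hle : ∀ i v w, R i v ≤ R i w → f i v ≤ f i w := fun i v w h => by
    by_contra! h1
    exact absurd (hfR i _ _ h1) (not_lt.2 h)
  have hdom' : ∀ y : GridPoint I N, ∃ i, Sum.inr i ∉ P ∧
      ∀ t : GridPoint I N, Sum.inl t ∈ P → (y.1 i : ℕ) ≤ t.1 i := by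
    intro y
    obtain ⟨i, hi⟩ := hdom (Sum.inl y)
    refine ⟨i, fun h => ?_, fun t ht => ?_⟩
    · have := hle i _ _ (hi _ h)
      simp [f] at this
    · have := hle i _ _ (hi _ ht)
      simpa [f] using this
  have hcol : ∀ i, Sum.inr i ∉ P → ∃ s : GridPoint I N, Sum.inl s ∈ P ∧ c s = i := by
    intro i hi
    have : i ∈ P.image (Sum.elim c id) := himg ▸ Finset.mem_univ i
    obtain ⟨v, hv, hvi⟩ := Finset.mem_image.1 this
    rcases v with s | j
    · exact ⟨s, hv, hvi⟩
    · exact absurd (show j = i from hvi) (fun h => hi (h ▸ hv))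
  let σ : Finset (GridPoint I N) := Finset.univ.filter fun t => Sum.inl t ∈ P
  have hσ : ∀ t, t ∈ σ ↔ Sum.inl t ∈ P := by simp [σ]
  obtain ⟨t₀, ht₀⟩ : σ.Nonempty := by
    obtain ⟨y, -⟩ := GridPoint.exists_ge (I := I) (N := N) (fun _ => 0) (by simp)
    obtain ⟨i, hi, -⟩ := hdom' y
    obtain ⟨s, hs, -⟩ := hcol i hi
    exact ⟨s, (hσ s).2 hs⟩
  choose μ hμ hμmin using fun i => σ.exists_min_image (fun t => (t.1 i : ℕ)) ⟨t₀, ht₀⟩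
  let a : I → ℕ := fun i => if Sum.inr i ∈ P then 0 else ((μ i).1 i : ℕ)
  have hale : ∀ t ∈ σ, ∀ i, a i ≤ t.1 i := by
    intro t ht i
    by_cases hi : Sum.inr i ∈ P
    · simp [a, hi]
    · simpa [a, hi] using hμmin i t ht
  -- Otherwise some grid point would exceed `a` in every coordinate, and no ranking could dominate
  -- it.
  have hsum : N < ∑ i, a i + Fintype.card I := by
    by_contra! h
    obtain ⟨y, hy⟩ := GridPoint.exists_ge (N := N) (fun i => a i + 1) (by
      rw [Finset.sum_add_distrib]
      simpa using h)
    obtain ⟨i, hi, hyi⟩ := hdom' y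
    have h1 := hyi _ ((hσ _).1 (hμ i))
    have h2 := hy i
    simp only [a, if_neg hi] at h2
    omega
  have hupper : ∀ t ∈ σ, ∀ i, (t.1 i : ℕ) ≤ a i + Fintype.card I := by
    intro t ht i
    have h1 : ∑ j ∈ Finset.univ.erase i, a j ≤ ∑ j ∈ Finset.univ.erase i, (t.1 j : ℕ) :=
      Finset.sum_le_sum fun j _ => hale t ht j
    have h2 := Finset.add_sum_erase Finset.univ a (Finset.mem_univ i)
    have h3 := Finset.add_sum_erase Finset.univ (fun j => (t.1 j : ℕ)) (Finset.mem_univ i)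
    have h4 := t.2
    omega
  refine ⟨t₀, fun i => ?_⟩
  by_cases hi : Sum.inr i ∈ P
  · left
    simpa [a, hi] using hupper t₀ ht₀ i
  · right
    obtain ⟨s, hs, hc⟩ := hcol i hi
    rw [← hσ] at hs
    exact ⟨s, hc, fun j => ⟨(hupper s hs j).trans (Nat.add_le_add_right (hale t₀ ht₀ j) _),
      (hupper t₀ ht₀ j).trans (Nat.add_le_add_right (hale s hs j) _)⟩⟩

/-- The point of the standard simplex given by a grid point. -/
noncomputable def GridPoint.toSimplex {I : Type*} [Fintype I] {N : ℕ} (t : GridPoint I (N + 1)) :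
    stdSimplex ℝ I :=
  ⟨fun i => (t.1 i : ℕ) / ((N + 1 : ℕ) : ℝ), fun i => by positivity, by
    rw [← Finset.sum_div, ← Nat.cast_sum, t.2]
    exact div_self (by positivity)⟩

open Filter Topology in
/-- The complementarity theorem on the simplex: a continuous vector field `F` on the standard
simplex has a point `q` whose positive coordinates are maximal coordinates of `F q`. -/
theorem stdSimplex.exists_complementary {I : Type*} [Fintype I] [Nonempty I]
    (F : stdSimplex ℝ I → I → ℝ) (hF : Continuous F) :
    ∃ q : stdSimplex ℝ I, ∀ i j, 0 < q.1 i → F q j ≤ F q i := by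
  classical
  rcases subsingleton_or_nontrivial I with hI | hI
  · obtain ⟨i₀⟩ := ‹Nonempty I›
    exact ⟨⟨_, single_mem_stdSimplex ℝ i₀⟩, fun i j _ => by rw [Subsingleton.elim j i]⟩
  choose c hc using fun q : stdSimplex ℝ I => Finite.exists_max (F q)
  choose t ht using fun N : ℕ =>
    GridPoint.exists_near_colors (I := I) (N + 1) (fun t => c t.toSimplex)
  let q : ℕ → stdSimplex ℝ I := fun N => (t N).toSimplex
  have hq : ∀ N i, q N i ≤ (Fintype.card I : ℝ) / (N + 1 : ℕ) ∨ ∃ p : stdSimplex ℝ I,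
      (∀ j, F p j ≤ F p i) ∧ dist p (q N) ≤ (Fintype.card I : ℝ) / (N + 1 : ℕ) := by
    intro N i
    have hN : (0 : ℝ) < ((N + 1 : ℕ) : ℝ) := by positivity
    rcases ht N i with h | ⟨s, hsc, hs⟩
    · left
      exact div_le_div_of_nonneg_right (by exact_mod_cast h) hN.le
    · right
      refine ⟨s.toSimplex, fun j => hsc ▸ hc _ j, ?_⟩
      rw [Subtype.dist_eq, dist_pi_le_iff (by positivity)]
      intro j
      change dist (((s.1 j : ℕ) : ℝ) / ((N + 1 : ℕ) : ℝ)) ((((t N).1 j : ℕ) : ℝ) / ((N + 1 : ℕ) : ℝ)) ≤ _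
      rw [Real.dist_eq, ← sub_div, abs_div, abs_of_pos hN]
      apply div_le_div_of_nonneg_right _ hN.le
      rw [abs_le]
      have h1 : ((s.1 j : ℕ) : ℝ) ≤ ((t N).1 j : ℕ) + Fintype.card I := by
        exact_mod_cast (hs j).1
      have h2 : (((t N).1 j : ℕ) : ℝ) ≤ (s.1 j : ℕ) + Fintype.card I := by
        exact_mod_cast (hs j).2
      constructor <;> linarith
  have hzero : Tendsto (fun N : ℕ => (Fintype.card I : ℝ) / (N + 1 : ℕ)) atTop (𝓝 0) :=
    (tendsto_const_div_atTop_nhds_zero_nat (Fintype.card I : ℝ)).comp (tendsto_add_atTop_nat 1)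
  have : CompactSpace (stdSimplex ℝ I) := isCompact_iff_compactSpace.1 (isCompact_stdSimplex ℝ I)
  obtain ⟨q₀, φ, hφ, hlim⟩ := CompactSpace.tendsto_subseq q
  refine ⟨q₀, fun i j hi => ?_⟩
  have hzero' := hzero.comp hφ.tendsto_atTop
  have hcoord : Tendsto (fun k => (q (φ k)).1 i) atTop (𝓝 (q₀.1 i)) :=
    (((continuous_apply i).comp continuous_subtype_val).tendsto q₀).comp hlim
  have hev : ∀ᶠ k in atTop, ∃ p : stdSimplex ℝ I,
      (∀ j, F p j ≤ F p i) ∧ dist p (q (φ k)) ≤ (Fintype.card I : ℝ) / (φ k + 1 : ℕ) := by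
    filter_upwards [hzero'.eventually_lt hcoord hi] with k hk
    exact (hq (φ k) i).resolve_left (not_le.2 hk)
  -- The nearby points exist only eventually; `q₀` is a default for the other indices.
  have hp : ∀ k, ∃ p : stdSimplex ℝ I, (∃ p' : stdSimplex ℝ I,
      (∀ j, F p' j ≤ F p' i) ∧ dist p' (q (φ k)) ≤ (Fintype.card I : ℝ) / (φ k + 1 : ℕ)) →
      (∀ j, F p j ≤ F p i) ∧ dist p (q (φ k)) ≤ (Fintype.card I : ℝ) / (φ k + 1 : ℕ) := by
    intro k
    by_cases h : ∃ p' : stdSimplex ℝ I,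
      (∀ j, F p' j ≤ F p' i) ∧ dist p' (q (φ k)) ≤ (Fintype.card I : ℝ) / (φ k + 1 : ℕ)
    · obtain ⟨p, hp⟩ := h
      exact ⟨p, fun _ => hp⟩
    · exact ⟨q₀, fun h' => absurd h' h⟩
  choose p hp using hp
  have hdist : Tendsto (fun k => dist (q (φ k)) (p k)) atTop (𝓝 0) := by
    refine squeeze_zero' (Eventually.of_forall fun _ => dist_nonneg) ?_ hzero'
    filter_upwards [hev] with k hk
    rw [dist_comm]
    exact (hp k hk).2
  have hplim : Tendsto p atTop (𝓝 q₀) := (tendsto_iff_of_dist hdist).1 hlim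
  have hFlim : ∀ l, Tendsto (fun k => F (p k) l) atTop (𝓝 (F q₀ l)) := fun l =>
    (((continuous_apply l).comp hF).tendsto q₀).comp hplim
  refine le_of_tendsto_of_tendsto (hFlim j) (hFlim i) ?_
  filter_upwards [hev] with k hk
  exact (hp k hk).1 j

/-! ### Priority exchanges and their limit. -/

namespace DataExchange

variable {n : ℕ}

/-- The exchange for the priorities `q`: agent `i` gives everything to the agents of at least its
own priority, nothing to those whose priority is lower by `δ` or more, and interpolates between. -/
noncomputable def priorityExchange (δ : ℝ) (q : Fin n → ℝ) : Exchange n :=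
  fun i j => Set.projIcc 0 1 zero_le_one (1 + (q j - q i) / δ)

theorem continuous_priorityExchange (δ : ℝ) :
    Continuous (priorityExchange δ : (Fin n → ℝ) → Exchange n) := by
  refine continuous_pi fun i => continuous_pi fun j => continuous_projIcc.comp ?_
  fun_prop

theorem priorityExchange_eq_one {δ : ℝ} (hδ : 0 < δ) {q : Fin n → ℝ} {i j : Fin n}
    (h : q i ≤ q j) : priorityExchange δ q i j = 1 := by
  refine Set.projIcc_of_right_le _ ?_
  have : 0 ≤ (q j - q i) / δ := div_nonneg (by linarith) hδ.le
  linarith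

theorem priorityExchange_eq_zero {δ : ℝ} (hδ : 0 < δ) {q : Fin n → ℝ} {i j : Fin n}
    (h : q j + δ ≤ q i) : priorityExchange δ q i j = 0 := by
  refine Set.projIcc_of_le_left _ ?_
  have : (q j - q i) / δ ≤ -1 := by
    rw [div_le_iff₀ hδ]
    linarith
  linarith

/-- In a coalition, the agent of highest priority cannot gain. -/
theorem exists_utility_le_priorityExchange (I : Instance n) {δ : ℝ} (hδ : 0 < δ) (q : Fin n → ℝ)
    {S : Finset (Fin n)} (hS : S.Nonempty) {y : Exchange n} (hy : y.IsAmong S) :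
    ∃ i ∈ S, I.u i (y.bundle i) ≤ I.u i ((priorityExchange δ q).bundle i) := by
  obtain ⟨i, hi, hmax⟩ := S.exists_max_image q hS
  refine ⟨i, hi, I.monotone_u i fun k => ?_⟩
  by_cases hk : k ∈ S
  · change y k i ≤ priorityExchange δ q k i
    rw [priorityExchange_eq_one hδ (hmax k hk)]
    exact unitInterval.le_one'
  · change y k i ≤ _
    rw [hy k i (Or.inl hk)]
    exact unitInterval.nonneg'

theorem continuous_bundle (i : Fin n) : Continuous fun x : Exchange n => x.bundle i :=
  continuous_pi fun k => (continuous_apply i).comp (continuous_apply k)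

theorem continuous_surplus {I : Instance n} {ψ : Fin n → Fin n → Bundle n → unitInterval}
    (hu : ∀ i, Continuous (I.u i)) (hψ : ∀ i j, Continuous (ψ i j)) (i : Fin n) :
    Continuous fun x : Exchange n => surplus I ψ x i := by
  unfold surplus
  refine Continuous.sub (continuous_finsetSum _ fun j _ => ?_) ?_
  · exact continuous_subtype_val.comp ((hψ i j).comp (continuous_bundle j))
  · exact continuous_subtype_val.comp ((hu i).comp (continuous_bundle i))

/-- By efficiency, each contribution `ψ i j` is credited to `i` and debited from `j`. -/
theorem sum_mul_surplus {I : Instance n} {ψ : Fin n → Fin n → Bundle n → unitInterval}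
    (hψ : IsShare I ψ) (x : Exchange n) (q : Fin n → ℝ) :
    ∑ i, q i * surplus I ψ x i = ∑ i, ∑ j, (q i - q j) * (ψ i j (x.bundle j) : ℝ) := by
  simp only [surplus, hψ.efficient, mul_sub, sub_mul, Finset.sum_sub_distrib, Finset.mul_sum]
  congr 1
  exact Finset.sum_comm

theorem sum_surplus {I : Instance n} {ψ : Fin n → Fin n → Bundle n → unitInterval}
    (hψ : IsShare I ψ) (x : Exchange n) : ∑ i, surplus I ψ x i = 0 := by
  simpa using sum_mul_surplus hψ x fun _ => 1

/-- Weighted by the priorities, the surpluses of a priority exchange have almost no positive sum. -/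
theorem sum_mul_surplus_priorityExchange_le {I : Instance n}
    {ψ : Fin n → Fin n → Bundle n → unitInterval} (hψ : IsShare I ψ) {δ : ℝ} (hδ : 0 < δ)
    (q : Fin n → ℝ) :
    ∑ i, q i * surplus I ψ (priorityExchange δ q) i ≤ (n : ℝ) * (n * δ) := by
  have hterm : ∀ i j, (q i - q j) * (ψ i j ((priorityExchange δ q).bundle j) : ℝ) ≤ δ := by
    intro i j
    have h0 := (ψ i j ((priorityExchange δ q).bundle j)).2.1
    have h1 := (ψ i j ((priorityExchange δ q).bundle j)).2.2
    rcases le_total (q j + δ) (q i) with h | h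
    · have hz : (priorityExchange δ q).bundle j i = 0 := priorityExchange_eq_zero hδ h
      rw [hψ.normalized i j _ hz]
      simpa using hδ.le
    · exact (mul_le_mul_of_nonneg_right (show q i - q j ≤ δ by linarith) h0).trans
        (mul_le_of_le_one_right hδ.le h1)
  rw [sum_mul_surplus hψ]
  calc _ ≤ ∑ _i : Fin n, ∑ _j : Fin n, δ :=
        Finset.sum_le_sum fun i _ => Finset.sum_le_sum fun j _ => hterm i j
    _ = _ := by simp

theorem exists_priorityExchange_surplus_le [NeZero n] {I : Instance n}
    {ψ : Fin n → Fin n → Bundle n → unitInterval} (hψ : IsShare I ψ)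
    (hu_cont : ∀ i, Continuous (I.u i)) (hψ_cont : ∀ i j, Continuous (ψ i j)) {δ : ℝ}
    (hδ : 0 < δ) :
    ∃ q : Fin n → ℝ, ∀ j, surplus I ψ (priorityExchange δ q) j ≤ (n : ℝ) * (n * δ) := by
  obtain ⟨q, hq⟩ := stdSimplex.exists_complementary
    (fun (q : stdSimplex ℝ (Fin n)) i => surplus I ψ (priorityExchange δ q.1) i)
    (continuous_pi fun i => (continuous_surplus hu_cont hψ_cont i).comp
      ((continuous_priorityExchange δ).comp continuous_subtype_val))
  refine ⟨q.1, fun j => ?_⟩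
  calc surplus I ψ (priorityExchange δ q.1) j
      = ∑ i, q.1 i * surplus I ψ (priorityExchange δ q.1) j := by
        rw [← Finset.sum_mul, q.2.2, one_mul]
    _ ≤ ∑ i, q.1 i * surplus I ψ (priorityExchange δ q.1) i := by
        refine Finset.sum_le_sum fun i _ => ?_
        rcases (q.2.1 i).eq_or_lt with h | h
        · simp [← h]
        · exact mul_le_mul_of_nonneg_left (hq i j h) h.le
    _ ≤ _ := sum_mul_surplus_priorityExchange_le hψ hδ q.1

open Filter Topology in
/-- There is a reciprocal exchange in which no coalition can make all its members better off. -/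
theorem exists_reciprocal_core {I : Instance n}
    {ψ : Fin n → Fin n → Bundle n → unitInterval} (hψ : IsShare I ψ)
    (hu_cont : ∀ i, Continuous (I.u i)) (hψ_cont : ∀ i j, Continuous (ψ i j)) :
    ∃ x : Exchange n, IsReciprocal I ψ x ∧ ∀ S : Finset (Fin n), S.Nonempty →
      ∀ y : Exchange n, y.IsAmong S → ∃ i ∈ S, I.u i (y.bundle i) ≤ I.u i (x.bundle i) := by
  rcases Nat.eq_zero_or_pos n with rfl | hn
  -- Without agents the simplex is empty.
  · exact ⟨fun _ _ => 0, fun i => i.elim0, fun S ⟨i, _⟩ => i.elim0⟩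
  have : NeZero n := ⟨hn.ne'⟩
  choose q hq using fun k : ℕ => exists_priorityExchange_surplus_le hψ hu_cont hψ_cont
    (δ := 1 / ((k : ℝ) + 1)) (by positivity)
  obtain ⟨x, φ, hφ, hlim⟩ := CompactSpace.tendsto_subseq
    fun k : ℕ => priorityExchange (1 / ((k : ℝ) + 1)) (q k)
  have hbound : Tendsto (fun k : ℕ => (n : ℝ) * (n * (1 / ((k : ℝ) + 1)))) atTop (𝓝 0) := by
    simpa using (tendsto_one_div_add_atTop_nhds_zero_nat.const_mul (n : ℝ)).const_mul (n : ℝ)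
  have hle : ∀ i, surplus I ψ x i ≤ 0 := fun i =>
    le_of_tendsto_of_tendsto (((continuous_surplus hu_cont hψ_cont i).tendsto x).comp hlim)
      (hbound.comp hφ.tendsto_atTop) (Eventually.of_forall fun k => hq (φ k) i)
  refine ⟨x, fun i => ?_, fun S hS y hy => ?_⟩
  · rw [(Finset.sum_eq_zero_iff_of_nonpos fun i _ => hle i).1 (sum_surplus hψ x) i
      (Finset.mem_univ i), abs_zero]
  · by_contra! hlt
    have hev : ∀ᶠ k in atTop, ∀ i ∈ S,
        I.u i ((priorityExchange (1 / ((φ k : ℝ) + 1)) (q (φ k))).bundle i) <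
          I.u i (y.bundle i) := by
      rw [Filter.eventually_all_finset]
      intro i hi
      exact ((((hu_cont i).comp (continuous_bundle i)).tendsto x).comp hlim).eventually_lt_const
        (hlt i hi)
    obtain ⟨k, hk⟩ := hev.exists
    obtain ⟨i, hi, h⟩ := exists_utility_le_priorityExchange I
      (δ := 1 / ((φ k : ℝ) + 1)) (by positivity) (q (φ k)) hS hy
    exact absurd h (not_le.2 (hk i hi))

end DataExchange

theorem theorem3 (n : ℕ) (I : DataExchange.Instance n)
    (ψ : Fin n → Fin n → DataExchange.Bundle n → unitInterval)
    (hψ : DataExchange.IsShare I ψ)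
    (hu_cont : ∀ i, Continuous (I.u i))
    (hψ_cont : ∀ i j, Continuous (ψ i j))
    (ε : ℝ) (hε : ε ∈ Set.Ioo (0 : ℝ) 1) :
    ∃ x : DataExchange.Exchange n,
      DataExchange.IsReciprocal I ψ x ∧ DataExchange.IsCoreStable I ε x := by
  obtain ⟨x, hrec, hcore⟩ := DataExchange.exists_reciprocal_core hψ hu_cont hψ_cont
  refine ⟨x, hrec, fun S hS => ?_⟩
  rintro ⟨y, hy, hgt⟩
  obtain ⟨i, hi, hle⟩ := hcore S hS y hy
  have h1 := hgt i hi
  have h2 : (I.u i (y.bundle i) : ℝ) ≤ I.u i (x.bundle i) := hle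
  linarith [hε.1]
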